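/- Let $n,m$ be nonnegative integers and let $A\in\mathbb R^{m\times m}$, $B\in\mathbb R^{m\times n}$, $C\in\mathbb R^{n\times m}$, $D\in\mathbb R^{n\times n}$. Put \[ K=\begin{bmatrix} D & -C\\ -B & A\end{bmatrix},\qquad H=\begin{bmatrix} D & -C\\ B & -A\end{bmatrix}. \] Inequalities between matrices or vectors are entrywise. A real square matrix $M$ with nonpositive off-diagonal entries is an $M$-matrix if $M=sI-N$ with $N\ge 0$ and $s\ge\rho(N)$, where $\rho$ is the spectral radius; it is a regular $M$-matrix if moreover $Mv\ge 0$ for some vector $v>0$. Assume that $K$ is a regular $M$-matrix. Then the equations \[ XCX-XD-AX+B=0\quad (X\in\mathbb R^{m\times n}),\qquad YBY-YA-DY+C=0\quad (Y\in\mathbb R^{n\times m}) \] have minimal (entrywise smallest) nonnegative solutions, denoted by $\Phi$ and $\Psi$ respectively. Let the eigenvalues of $H$, counted with algebraic multiplicity, be arranged in descending order by their real parts, $\lambda_1,\dots,\lambda_n,\lambda_{n+1},\dots,\lambda_{n+m}$ (in any such arrangement). Then, counted with algebraic multiplicity, the eigenvalues of $A-\Phi C$ are $-\lambda_{n+1},\dots,-\lambda_{n+m}$,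 and the eigenvalues of $D-\Psi B$ are $\lambda_1,\dots,\lambda_n$. In particular, $D-\Psi B$ is nonsingular if and only if $D-C\Phi$ is nonsingular, and $A-\Phi C$ is nonsingular if and only if $A-B\Psi$ is nonsingular. -/

import Mathlib

open Matrix

/-- A real square matrix is a `Z`-matrix if all its off-diagonal entries are nonpositive. -/
def IsZMatrix {ι : Type*} (M : Matrix ι ι ℝ) : Prop :=
  ∀ i j, i ≠ j → M i j ≤ 0

/-- A `Z`-matrix `M` is an `M`-matrix if `M = s I - N` with `N ≥ 0` entrywise and `s ≥ ρ(N)`.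
The spectral radius is the largest modulus of a complex eigenvalue; as an element of `[0, ∞]` it is
compared with `s`, which is then necessarily nonnegative. -/
def IsMMatrix {ι : Type*} [Fintype ι] [DecidableEq ι] (M : Matrix ι ι ℝ) : Prop :=
  IsZMatrix M ∧
    ∃ (s : ℝ) (N : Matrix ι ι ℝ), (∀ i j, 0 ≤ N i j) ∧ M = s • (1 : Matrix ι ι ℝ) - N ∧
      0 ≤ s ∧ spectralRadius ℂ (N.map (fun x : ℝ => (x : ℂ))) ≤ ENNReal.ofReal s

/-- An `M`-matrix `M` is regular if `M v ≥ 0` for some entrywise positive vector `v`. -/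
def IsRegularMMatrix {ι : Type*} [Fintype ι] [DecidableEq ι] (M : Matrix ι ι ℝ) : Prop :=
  IsMMatrix M ∧ ∃ v : ι → ℝ, (∀ i, 0 < v i) ∧ ∀ i, 0 ≤ (M *ᵥ v) i

/-- `X` is an entrywise nonnegative solution of `X C X - X D - A X + B = 0`. -/
def IsNonnegSolution {n m : ℕ} (A : Matrix (Fin m) (Fin m) ℝ) (B : Matrix (Fin m) (Fin n) ℝ)
    (C : Matrix (Fin n) (Fin m) ℝ) (D : Matrix (Fin n) (Fin n) ℝ)
    (X : Matrix (Fin m) (Fin n) ℝ) : Prop :=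
  (∀ i j, 0 ≤ X i j) ∧ X * C * X - X * D - A * X + B = 0

/-- `X` is the entrywise smallest nonnegative solution of `X C X - X D - A X + B = 0`. -/
def IsMinimalNonnegSolution {n m : ℕ} (A : Matrix (Fin m) (Fin m) ℝ)
    (B : Matrix (Fin m) (Fin n) ℝ) (C : Matrix (Fin n) (Fin m) ℝ)
    (D : Matrix (Fin n) (Fin n) ℝ) (X : Matrix (Fin m) (Fin n) ℝ) : Prop :=
  IsNonnegSolution A B C D X ∧ ∀ Y, IsNonnegSolution A B C D Y → ∀ i j, X i j ≤ Y i j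

/-- The matrix `K = [D, -C; -B, A]`. -/
def riccatiK {n m : ℕ} (A : Matrix (Fin m) (Fin m) ℝ) (B : Matrix (Fin m) (Fin n) ℝ)
    (C : Matrix (Fin n) (Fin m) ℝ) (D : Matrix (Fin n) (Fin n) ℝ) :
    Matrix (Fin n ⊕ Fin m) (Fin n ⊕ Fin m) ℝ :=
  fromBlocks D (-C) (-B) A

/-- The matrix `H = [D, -C; B, -A]`. -/
def riccatiH {n m : ℕ} (A : Matrix (Fin m) (Fin m) ℝ) (B : Matrix (Fin m) (Fin n) ℝ)
    (C : Matrix (Fin n) (Fin m) ℝ) (D : Matrix (Fin n) (Fin n) ℝ) :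
    Matrix (Fin n ⊕ Fin m) (Fin n ⊕ Fin m) ℝ :=
  fromBlocks D (-C) B (-A)

/-- The finite family `μ` lists all complex eigenvalues of the real matrix `M`, each as often as
its algebraic multiplicity. -/
def ListsEigenvalues {ι κ : Type*} [Fintype ι] [DecidableEq ι] [Fintype κ]
    (M : Matrix ι ι ℝ) (μ : κ → ℂ) : Prop :=
  (M.map (fun x : ℝ => (x : ℂ))).charpoly.roots = Finset.univ.val.map μ

/-!
`K = [D, -C; -B, A]` being a regular `M`-matrix is used only through `K` being a `Z`-matrix with
`K v ≥ 0` for some `v = (v₁, v₂) > 0`.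

A solution `Φ` of the first equation makes the columns of `[I; Φ]` span an invariant subspace of
`H`, so `H` is similar to `[D - C Φ, -C; 0, -(A - Φ C)]` (`complexEigenvalues_fromBlocks`). Suppose
that all eigenvalues of `D - C Φ` and of `A - Φ C` have positive real part or are zero. Then the
eigenvalues of `D - C Φ` are the first `n` ones of `H` and those of `-(A - Φ C)` the last `m` ones;
ties in the ordering do no harm, since they can only occur at the eigenvalue zero (`sorted_split`).
The same applies to the second equation, which belongs to a permutation of `-H`. The two
resulting splittings of the spectrum of `H` coincide (`eq_and_eq_of_add_eq_add`), which gives the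
statements about `D - Ψ B`, `A - B Ψ` and about nonsingularity.

For the location of the spectra, a weighted Gershgorin estimate (`IsZMatrix.norm_sub_le`) puts the
eigenvalues of a `Z`-matrix `M` with `M w ≥ 0`, `w > 0`, into the disc of centre and radius `s`,
where `s` is any upper bound of the diagonal. For `M = D - C Φ` take `w = v₁`, as the minimal
solution satisfies `Φ v₁ ≤ v₂`. For `A - Φ C` a positive left vector is needed. When `K v > 0`, it is
obtained from a row vector `u ≥ 0` with `u K > 0` (`exists_pos_vecMul_sub_mul_pos`). In general, `K` is
replaced by `K + ε I`: the minimal solutions for `K + ε I`, constructed by a monotone iteration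
(`exists_minimal_solution_of_pos`), increase to `Φ` as `ε` decreases to `0`, and the disc, which can
be chosen independently of `ε`, is inherited by the limit because the characteristic polynomials
stay away from zero outside it (`norm_sub_le_of_tendsto`, `exists_minimal_solution`).
-/

/-! ### Monotonicity of `Z`-matrices `M` with `M v > 0` for some `v > 0` -/

section ZMatrix

variable {ι : Type*} [Fintype ι]

/-- Maximum principle: look at an index where `x i / v i` is smallest. -/
theorem IsZMatrix.nonneg_of_mulVec_nonneg {M : Matrix ι ι ℝ} (hM : IsZMatrix M) {v : ι → ℝ}
    (hv : ∀ i, 0 < v i) (hMv : ∀ i, 0 < (M *ᵥ v) i) {x : ι → ℝ} (hx : ∀ i, 0 ≤ (M *ᵥ x) i) (i : ι) :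
    0 ≤ x i := by
  have : Nonempty ι := ⟨i⟩
  obtain ⟨k, hk⟩ := Finite.exists_min fun j => x j / v j
  set t := x k / v k with ht
  have hle : ∀ j, t * v j ≤ x j := fun j => (le_div_iff₀ (hv j)).1 (hk j)
  have hxk : x k = t * v k := by rw [ht, div_mul_cancel₀ _ (hv k).ne']
  have ht0 : 0 ≤ t := by
    by_contra! hneg
    have h1 : (M *ᵥ x) k ≤ t * (M *ᵥ v) k := by
      simp only [mulVec, dotProduct, Finset.mul_sum]
      refine Finset.sum_le_sum fun j _ => ?_
      by_cases hkj : k = j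
      · subst hkj; rw [hxk]; exact le_of_eq (by ring)
      · nlinarith [mul_le_mul_of_nonpos_left (hle j) (hM k j hkj)]
    nlinarith [hx k, hMv k]
  exact (mul_nonneg ht0 (hv i).le).trans (hle i)

theorem IsZMatrix.pos_of_mulVec_pos {M : Matrix ι ι ℝ} (hM : IsZMatrix M) {x : ι → ℝ}
    (hx : ∀ i, 0 ≤ x i) {i : ι} (hi : 0 < (M *ᵥ x) i) : 0 < M i i ∧ 0 < x i := by
  classical
  have h1 : (M *ᵥ x) i ≤ M i i * x i := by
    rw [mulVec, dotProduct, ← Finset.add_sum_erase _ _ (Finset.mem_univ i)]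
    have : ∑ j ∈ Finset.univ.erase i, M i j * x j ≤ 0 :=
      Finset.sum_nonpos fun j hj =>
        mul_nonpos_of_nonpos_of_nonneg (hM i j (Finset.ne_of_mem_erase hj).symm) (hx j)
    linarith
  have h2 : 0 < M i i * x i := hi.trans_le h1
  exact ⟨pos_of_mul_pos_left h2 (hx i), (hx i).lt_of_ne fun h => by simp [← h] at h2⟩

variable [DecidableEq ι]

theorem IsZMatrix.isUnit_det {M : Matrix ι ι ℝ} (hM : IsZMatrix M) {v : ι → ℝ}
    (hv : ∀ i, 0 < v i) (hMv : ∀ i, 0 < (M *ᵥ v) i) : IsUnit M.det := by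
  rw [isUnit_iff_ne_zero]
  intro h
  obtain ⟨x, hx0, hx⟩ := exists_mulVec_eq_zero_iff.2 h
  refine hx0 (funext fun i => le_antisymm ?_ ?_)
  · have := hM.nonneg_of_mulVec_nonneg hv hMv (x := -x) (fun i => by simp [mulVec_neg, hx]) i
    simpa using this
  · exact hM.nonneg_of_mulVec_nonneg hv hMv (fun i => by simp [hx]) i

theorem IsZMatrix.inv_nonneg {M : Matrix ι ι ℝ} (hM : IsZMatrix M) {v : ι → ℝ}
    (hv : ∀ i, 0 < v i) (hMv : ∀ i, 0 < (M *ᵥ v) i) (i j : ι) : 0 ≤ M⁻¹ i j := by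
  have h := hM.nonneg_of_mulVec_nonneg hv hMv (x := M⁻¹ *ᵥ Pi.single j 1) (fun k => by
    rw [mulVec_mulVec, mul_nonsing_inv _ (hM.isUnit_det hv hMv), one_mulVec]
    by_cases hkj : k = j
    · subst hkj; simp
    · simp [hkj]) i
  simpa using h

/-- The transposed matrix is monotone as well, although the positive vector belongs to `M`. -/
theorem IsZMatrix.nonneg_of_vecMul_nonneg {M : Matrix ι ι ℝ} (hM : IsZMatrix M) {v : ι → ℝ}
    (hv : ∀ i, 0 < v i) (hMv : ∀ i, 0 < (M *ᵥ v) i) {x : ι → ℝ} (hx : ∀ i, 0 ≤ (x ᵥ* M) i) (i : ι) :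
    0 ≤ x i := by
  have h : x = (x ᵥ* M) ᵥ* M⁻¹ := by
    rw [vecMul_vecMul, mul_nonsing_inv _ (hM.isUnit_det hv hMv), vecMul_one]
  rw [h]
  exact Finset.sum_nonneg fun j _ => mul_nonneg (hx j) (hM.inv_nonneg hv hMv j i)

/-- A nonsingular `M`-matrix also has a left vector `u` with `u M > 0`: take the column sums of `M⁻¹`. -/
theorem IsZMatrix.exists_vecMul_pos {M : Matrix ι ι ℝ} (hM : IsZMatrix M) {v : ι → ℝ}
    (hv : ∀ i, 0 < v i) (hMv : ∀ i, 0 < (M *ᵥ v) i) :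
    ∃ u : ι → ℝ, (∀ i, 0 ≤ u i) ∧ ∀ i, 0 < (u ᵥ* M) i := by
  refine ⟨(fun _ => 1) ᵥ* M⁻¹, fun i => Finset.sum_nonneg fun j _ => ?_, fun i => ?_⟩
  · simpa using hM.inv_nonneg hv hMv j i
  · rw [vecMul_vecMul, nonsing_inv_mul _ (hM.isUnit_det hv hMv), vecMul_one]
    exact one_pos

/-! ### Location of the eigenvalues -/

/-- The complex eigenvalues of a real matrix, with algebraic multiplicity. -/
noncomputable def complexEigenvalues (M : Matrix ι ι ℝ) : Multiset ℂ :=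
  (M.map (fun x : ℝ => (x : ℂ))).charpoly.roots

theorem card_complexEigenvalues (M : Matrix ι ι ℝ) :
    Multiset.card (complexEigenvalues M) = Fintype.card ι := by
  rw [complexEigenvalues, ← (IsAlgClosed.splits _).natDegree_eq_card_roots,
    charpoly_natDegree_eq_dim]

theorem mem_complexEigenvalues {M : Matrix ι ι ℝ} {z : ℂ} :
    z ∈ complexEigenvalues M ↔ (M.map (fun x : ℝ => (x : ℂ))).charpoly.eval z = 0 := by
  rw [complexEigenvalues, Polynomial.mem_roots (charpoly_monic _).ne_zero, Polynomial.IsRoot.def]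

theorem exists_eigenvector {M : Matrix ι ι ℝ} {z : ℂ} (hz : z ∈ complexEigenvalues M) :
    ∃ x : ι → ℂ, x ≠ 0 ∧ ∀ i, z * x i = ∑ j, (M i j : ℂ) * x j := by
  rw [mem_complexEigenvalues, eval_charpoly] at hz
  obtain ⟨x, hx0, hx⟩ := exists_mulVec_eq_zero_iff.2 hz
  refine ⟨x, hx0, fun i => ?_⟩
  have := congrFun hx i
  rw [sub_mulVec, Pi.sub_apply, Pi.zero_apply, sub_eq_zero] at this
  rw [scalar_apply, mulVec_diagonal] at this
  exact this

theorem complexEigenvalues_transpose (M : Matrix ι ι ℝ) :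
    complexEigenvalues Mᵀ = complexEigenvalues M := by
  rw [complexEigenvalues, complexEigenvalues, transpose_map, charpoly_transpose]

theorem complexEigenvalues_neg (M : Matrix ι ι ℝ) :
    complexEigenvalues (-M) = (complexEigenvalues M).map fun z => -z := by
  set N := M.map (fun x : ℝ => (x : ℂ)) with hN
  have h : ((-M).map (fun x : ℝ => (x : ℂ))).charpoly =
      (-1 : Polynomial ℂ) ^ Fintype.card ι * N.charpoly.comp (-Polynomial.X) := by
    refine Polynomial.funext fun z => ?_
    have h1 : (-M).map (fun x : ℝ => (x : ℂ)) = -N := by ext; simp [hN]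
    rw [h1, eval_charpoly, Polynomial.eval_mul, Polynomial.eval_comp, eval_charpoly]
    simp only [Polynomial.eval_pow, Polynomial.eval_neg, Polynomial.eval_one, Polynomial.eval_X]
    rw [← det_neg, map_neg]
    congr 1
    abel
  rw [complexEigenvalues, h, ← Polynomial.C_1, ← Polynomial.C_neg, ← Polynomial.C_pow,
    Polynomial.roots_C_mul _ (by simp), Polynomial.roots_comp_neg_X]
  rfl

theorem isUnit_iff_zero_notMem_complexEigenvalues (M : Matrix ι ι ℝ) :
    IsUnit M ↔ (0 : ℂ) ∉ complexEigenvalues M := by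
  have h : (M.map (fun x : ℝ => (x : ℂ))).det = (M.det : ℂ) := by
    exact (RingHom.map_det Complex.ofRealHom M).symm
  rw [isUnit_iff_isUnit_det, isUnit_iff_ne_zero, not_iff_not.symm, not_not, not_not,
    ← Multiset.prod_eq_zero_iff, complexEigenvalues, ← det_eq_prod_roots_charpoly, h,
    Complex.ofReal_eq_zero]

/-- A weighted Gershgorin estimate: `M = s I - N` with `N ≥ 0` and `N v ≤ s v`, so every eigenvalue
of `N` has modulus at most `s`. -/
theorem IsZMatrix.norm_sub_le {M : Matrix ι ι ℝ} (hM : IsZMatrix M) {v : ι → ℝ}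
    (hv : ∀ i, 0 < v i) (hMv : ∀ i, 0 ≤ (M *ᵥ v) i) {s : ℝ} (hs : ∀ i, M i i ≤ s) {z : ℂ}
    (hz : z ∈ complexEigenvalues M) : ‖(s : ℂ) - z‖ ≤ s := by
  obtain ⟨x, hx0, hx⟩ := exists_eigenvector hz
  obtain ⟨i₀, hi₀⟩ := Function.ne_iff.1 hx0
  have : Nonempty ι := ⟨i₀⟩
  obtain ⟨k, hk⟩ := Finite.exists_max fun j => ‖x j‖ / v j
  set t := ‖x k‖ / v k with ht
  have hle : ∀ j, ‖x j‖ ≤ t * v j := fun j => (div_le_iff₀ (hv j)).1 (hk j)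
  have hxk : ‖x k‖ = t * v k := by rw [ht, div_mul_cancel₀ _ (hv k).ne']
  have ht0 : 0 < t := (div_pos (norm_pos_iff.2 hi₀) (hv i₀)).trans_le (hk i₀)
  have hxk0 : 0 < ‖x k‖ := hxk ▸ mul_pos ht0 (hv k)
  let N : Matrix ι ι ℝ := s • 1 - M
  have hN : ∀ j, 0 ≤ N k j := fun j => by
    by_cases hkj : k = j
    · subst hkj; simpa [N] using hs k
    · simpa [N, hkj] using hM k j hkj
  have h1 : ((s : ℂ) - z) * x k = ∑ j, (N k j : ℂ) * x j := by
    rw [sub_mul, hx k]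
    simp [N, sub_mul, Finset.sum_sub_distrib, one_apply, apply_ite Complex.ofReal, ite_mul]
  have h2 : ‖(s : ℂ) - z‖ * ‖x k‖ ≤ s * ‖x k‖ := calc
    ‖(s : ℂ) - z‖ * ‖x k‖ = ‖∑ j, (N k j : ℂ) * x j‖ := by rw [← norm_mul, h1]
    _ ≤ ∑ j, N k j * (t * v j) := by
      refine (norm_sum_le _ _).trans (Finset.sum_le_sum fun j _ => ?_)
      rw [norm_mul, Complex.norm_real, Real.norm_of_nonneg (hN j)]
      exact mul_le_mul_of_nonneg_left (hle j) (hN j)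
    _ = t * (s * v k - (M *ᵥ v) k) := by
      have : s * v k - (M *ᵥ v) k = (N *ᵥ v) k := by
        simp [N, sub_mulVec, smul_mulVec]
      rw [this, mulVec, dotProduct, Finset.mul_sum]
      exact Finset.sum_congr rfl fun j _ => by ring
    _ ≤ s * ‖x k‖ := by rw [hxk]; nlinarith [hMv k, mul_nonneg ht0.le (hMv k)]
  exact le_of_mul_le_mul_right h2 hxk0

/-- If the eigenvalues of matrices `M k` lie in a closed disc, so do those of the limit: outside the
disc the characteristic polynomials are bounded away from zero. -/
theorem norm_sub_le_of_tendsto {M : ℕ → Matrix ι ι ℝ} {L : Matrix ι ι ℝ}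
    (hM : Filter.Tendsto M Filter.atTop (nhds L)) {c : ℂ} {r : ℝ}
    (h : ∀ k, ∀ z ∈ complexEigenvalues (M k), ‖c - z‖ ≤ r) {z : ℂ}
    (hz : z ∈ complexEigenvalues L) : ‖c - z‖ ≤ r := by
  by_contra! hlt
  set d := ‖c - z‖ - r with hd
  have hd0 : 0 < d := sub_pos.2 hlt
  let f : Matrix ι ι ℝ → ℂ := fun P => (P.map (fun x : ℝ => (x : ℂ))).charpoly.eval z
  have hf : Continuous f := by
    simp only [f, eval_charpoly]
    exact Continuous.matrix_det
      (continuous_const.sub (continuous_id.matrix_map Complex.continuous_ofReal))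
  have hlow : ∀ k, d ^ Fintype.card ι ≤ ‖f (M k)‖ := fun k => by
    simp only [f]
    rw [(IsAlgClosed.splits _).eval_eq_prod_roots_of_monic (charpoly_monic _),
      ← card_complexEigenvalues (M k), ← complexEigenvalues]
    have hmem := h k
    generalize complexEigenvalues (M k) = S at hmem
    induction S using Multiset.induction_on with
    | empty => simp
    | cons a S ih =>
      rw [Multiset.card_cons, Multiset.map_cons, Multiset.prod_cons, norm_mul, pow_succ']
      refine mul_le_mul ?_ (ih fun w hw => hmem w (Multiset.mem_cons_of_mem hw)) (by positivity)
        (norm_nonneg _)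
      have h1 := hmem a (Multiset.mem_cons_self a S)
      have h2 : ‖c - z‖ ≤ ‖c - a‖ + ‖z - a‖ := by
        have := norm_sub_le (c - a) (z - a)
        simpa using this
      linarith
  have hlim := ((hf.tendsto L).comp hM).norm
  have := ge_of_tendsto' hlim hlow
  rw [mem_complexEigenvalues] at hz
  simp only [f, hz, norm_zero] at this
  exact absurd this (not_le.2 (pow_pos hd0 _))

theorem re_pos_or_eq_zero_of_norm_sub_le {s : ℝ} {z : ℂ} (h : ‖(s : ℂ) - z‖ ≤ s) :
    0 < z.re ∨ z = 0 := by
  have h0 : 0 ≤ s := (norm_nonneg _).trans h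
  have h1 : ‖(s : ℂ) - z‖ ^ 2 ≤ s ^ 2 := pow_le_pow_left₀ (norm_nonneg _) h 2
  rw [Complex.sq_norm, Complex.normSq_apply] at h1
  simp only [Complex.sub_re, Complex.ofReal_re, Complex.sub_im, Complex.ofReal_im] at h1
  rcases lt_or_ge 0 z.re with hre | hre
  · exact Or.inl hre
  · right
    have h2 : 0 ≤ s * -z.re := mul_nonneg h0 (by linarith)
    apply Complex.ext <;> simp <;> nlinarith [sq_nonneg z.re, sq_nonneg z.im]

end ZMatrix

/-! ### Splitting a sorted list of eigenvalues -/

theorem eq_filter_add_replicate {S : Multiset ℂ} (hS : ∀ z ∈ S, 0 < z.re ∨ z = 0) :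
    S = S.filter (fun z => 0 < z.re) +
      Multiset.replicate (Multiset.card S - Multiset.card (S.filter fun z => 0 < z.re)) 0 := by
  conv_lhs => rw [← Multiset.filter_add_not (fun z : ℂ => 0 < z.re) S]
  congr 1
  refine Multiset.eq_replicate.2 ⟨?_, fun z hz => ?_⟩
  · have := congrArg Multiset.card (Multiset.filter_add_not (fun z : ℂ => 0 < z.re) S)
    rw [Multiset.card_add] at this
    omega
  · obtain ⟨h1, h2⟩ := Multiset.mem_filter.1 hz
    exact (hS z h1).resolve_left h2

/-- The splitting of a multiset into `n` points of the right half-plane and points of the left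
half-plane is unique, because `0` is the only admissible point of the imaginary axis. -/
theorem eq_and_eq_of_add_eq_add {S T S' T' : Multiset ℂ} (h : S + T = S' + T')
    (hcard : Multiset.card S = Multiset.card S')
    (hS : ∀ z ∈ S, 0 < z.re ∨ z = 0) (hT : ∀ z ∈ T, z.re ≤ 0)
    (hS' : ∀ z ∈ S', 0 < z.re ∨ z = 0) (hT' : ∀ z ∈ T', z.re ≤ 0) : S = S' ∧ T = T' := by
  have hf := congrArg (Multiset.filter fun z : ℂ => 0 < z.re) h
  rw [Multiset.filter_add, Multiset.filter_add,
    Multiset.filter_eq_nil.2 fun z hz => not_lt.2 (hT z hz),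
    Multiset.filter_eq_nil.2 fun z hz => not_lt.2 (hT' z hz), add_zero, add_zero] at hf
  have hSS : S = S' := by
    rw [eq_filter_add_replicate hS, eq_filter_add_replicate hS', hf, hcard]
  subst hSS
  exact ⟨rfl, add_left_cancel h⟩

theorem univ_val_map_fin_add {n m : ℕ} (ev : Fin (n + m) → ℂ) :
    Finset.univ.val.map ev = Finset.univ.val.map (fun i : Fin n => ev (Fin.castAdd m i)) +
      Finset.univ.val.map (fun i : Fin m => ev (Fin.natAdd n i)) := by
  rw [Fin.univ_val_map, Fin.univ_val_map, Fin.univ_val_map, Multiset.coe_add, ← List.ofFn_fin_append,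
    Fin.append_castAdd_natAdd]

theorem card_filter_map_of_forall {κ : Type*} [Fintype κ] (f : κ → ℂ) (p : ℂ → Prop)
    [DecidablePred p] (h : ∀ i, p (f i)) :
    Multiset.card ((Finset.univ.val.map f).filter p) = Fintype.card κ := by
  rw [Multiset.filter_eq_self.2 (by simpa using h)]
  simp

/-- A list sorted by descending real parts whose members form `S + T`, with `S` in the right and `T`
in the left half-plane, starts with the members of `S` and ends with those of `T`. -/
theorem sorted_split {n m : ℕ} {ev : Fin (n + m) → ℂ} {S T : Multiset ℂ}
    (hev : S + T = Finset.univ.val.map ev) (hsort : ∀ i j, i ≤ j → (ev j).re ≤ (ev i).re)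
    (hSn : Multiset.card S = n) (hTm : Multiset.card T = m)
    (hS : ∀ z ∈ S, 0 < z.re ∨ z = 0) (hT : ∀ z ∈ T, z.re < 0 ∨ z = 0) :
    S = Finset.univ.val.map (fun i : Fin n => ev (Fin.castAdd m i)) ∧
      T = Finset.univ.val.map (fun i : Fin m => ev (Fin.natAdd n i)) := by
  have hT0 : ∀ z ∈ T, z.re ≤ 0 := fun z hz => (hT z hz).elim le_of_lt fun h => by simp [h]
  have hS0 : ∀ z ∈ S, 0 ≤ z.re := fun z hz => (hS z hz).elim le_of_lt fun h => by simp [h]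
  have hle : ∀ (i : Fin n) (j : Fin m), (ev (Fin.natAdd n j)).re ≤ (ev (Fin.castAdd m i)).re :=
    fun i j => hsort _ _ (by rw [Fin.le_def]; simp only [Fin.val_castAdd, Fin.val_natAdd]; omega)
  have hall : ∀ i, 0 < (ev i).re ∨ (ev i).re < 0 ∨ ev i = 0 := fun i => by
    have hi : ev i ∈ S + T := hev ▸ Multiset.mem_map_of_mem ev (Finset.mem_univ_val i)
    rcases Multiset.mem_add.1 hi with h | h
    · exact (hS _ h).imp_right Or.inr
    · exact Or.inr (hT _ h)
  -- More than `n` members of positive real part, or more than `m` of negative one, do not fit.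
  have hneg : ∀ j : Fin m, (ev (Fin.natAdd n j)).re ≤ 0 := by
    intro j
    by_contra! hj
    have hc := congrArg (fun U => Multiset.card (U.filter fun z : ℂ => 0 < z.re)) hev
    simp only [univ_val_map_fin_add, Multiset.filter_add, Multiset.card_add] at hc
    rw [Multiset.filter_eq_nil.2 fun z hz => not_lt.2 (hT0 z hz),
      card_filter_map_of_forall (fun i : Fin n => ev (Fin.castAdd m i)) _
        fun i => hj.trans_le (hle i j)] at hc
    have h1 : 0 < Multiset.card ((Finset.univ.val.map
        fun i : Fin m => ev (Fin.natAdd n i)).filter fun z => 0 < z.re) :=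
      Multiset.card_pos_iff_exists_mem.2 ⟨_, Multiset.mem_filter.2
        ⟨Multiset.mem_map_of_mem _ (Finset.mem_univ_val j), hj⟩⟩
    have h2 := Multiset.card_le_card (Multiset.filter_le (fun z : ℂ => 0 < z.re) S)
    simp only [Multiset.card_zero, Fintype.card_fin] at hc
    omega
  have hpos : ∀ i : Fin n, 0 ≤ (ev (Fin.castAdd m i)).re := by
    intro i
    by_contra! hi
    have hc := congrArg (fun U => Multiset.card (U.filter fun z : ℂ => z.re < 0)) hev
    simp only [univ_val_map_fin_add, Multiset.filter_add, Multiset.card_add] at hc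
    rw [Multiset.filter_eq_nil.2 fun z hz => not_lt.2 (hS0 z hz),
      card_filter_map_of_forall (fun i : Fin m => ev (Fin.natAdd n i)) _
        fun j => (hle i j).trans_lt hi] at hc
    have h1 : 0 < Multiset.card ((Finset.univ.val.map
        fun i : Fin n => ev (Fin.castAdd m i)).filter fun z => z.re < 0) :=
      Multiset.card_pos_iff_exists_mem.2 ⟨_, Multiset.mem_filter.2
        ⟨Multiset.mem_map_of_mem _ (Finset.mem_univ_val i), hi⟩⟩
    have h2 := Multiset.card_le_card (Multiset.filter_le (fun z : ℂ => z.re < 0) T)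
    simp only [Multiset.card_zero, Fintype.card_fin] at hc
    omega
  refine eq_and_eq_of_add_eq_add (hev.trans (univ_val_map_fin_add ev)) (by simp [hSn]) hS hT0 ?_ ?_
  · intro z hz
    obtain ⟨i, -, rfl⟩ := Multiset.mem_map.1 hz
    rcases hall (Fin.castAdd m i) with h | h | h
    · exact Or.inl h
    · exact absurd (hpos i) (not_le.2 h)
    · exact Or.inr h
  · intro z hz
    obtain ⟨i, -, rfl⟩ := Multiset.mem_map.1 hz
    exact hneg i

/-! ### The minimal nonnegative solution when `K v > 0` -/

section Riccati

theorem Matrix.mul_apply_nonneg {ι κ μ : Type*} [Fintype κ] {P : Matrix ι κ ℝ} {Q : Matrix κ μ ℝ}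
    (hP : ∀ i j, 0 ≤ P i j) (hQ : ∀ i j, 0 ≤ Q i j) (i : ι) (j : μ) : 0 ≤ (P * Q) i j :=
  Finset.sum_nonneg fun k _ => mul_nonneg (hP i k) (hQ k j)

theorem Matrix.mul_apply_le_mul_apply {ι κ μ : Type*} [Fintype κ] {P P' : Matrix ι κ ℝ}
    {Q Q' : Matrix κ μ ℝ} (hP : ∀ i j, P i j ≤ P' i j) (hQ : ∀ i j, Q i j ≤ Q' i j)
    (hP' : ∀ i j, 0 ≤ P' i j) (hQ0 : ∀ i j, 0 ≤ Q i j) (i : ι) (j : μ) :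
    (P * Q) i j ≤ (P' * Q') i j :=
  Finset.sum_le_sum fun k _ => mul_le_mul (hP i k) (hQ k j) (hQ0 k j) (hP' i k)

theorem Matrix.mulVec_apply_nonneg {ι κ : Type*} [Fintype κ] {P : Matrix ι κ ℝ} {x : κ → ℝ}
    (hP : ∀ i j, 0 ≤ P i j) (hx : ∀ j, 0 ≤ x j) (i : ι) : 0 ≤ (P *ᵥ x) i :=
  Finset.sum_nonneg fun k _ => mul_nonneg (hP i k) (hx k)

theorem Matrix.mulVec_apply_mono {ι κ : Type*} [Fintype κ] {P : Matrix ι κ ℝ} {x y : κ → ℝ}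
    (hP : ∀ i j, 0 ≤ P i j) (hx : ∀ j, x j ≤ y j) (i : ι) : (P *ᵥ x) i ≤ (P *ᵥ y) i :=
  Finset.sum_le_sum fun k _ => mul_le_mul_of_nonneg_left (hx k) (hP i k)

/-- Nonnegative matrices with `X v ≤ w`, for a fixed `v > 0`, form an entrywise bounded set, so
increasing sequences of them converge. -/
theorem exists_tendsto_of_monotone_of_mulVec_le {ι κ : Type*} [Fintype κ] {v : κ → ℝ}
    {w : ι → ℝ} (hv : ∀ j, 0 < v j) {x : ℕ → Matrix ι κ ℝ} (hx : ∀ k i j, 0 ≤ x k i j)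
    (hmono : ∀ i j, Monotone fun k => x k i j) (hxv : ∀ k i, (x k *ᵥ v) i ≤ w i) :
    ∃ X : Matrix ι κ ℝ, Filter.Tendsto x Filter.atTop (nhds X) ∧
      ∀ i j, Filter.Tendsto (fun k => x k i j) Filter.atTop (nhds (X i j)) := by
  have hbdd : ∀ i j, BddAbove (Set.range fun k => x k i j) := by
    rintro i j
    refine ⟨w i / v j, ?_⟩
    rintro _ ⟨k, rfl⟩
    rw [le_div_iff₀ (hv j)]
    exact (Finset.single_le_sum (f := fun l => x k i l * v l)
      (fun l _ => mul_nonneg (hx k i l) (hv l).le) (Finset.mem_univ j)).trans (hxv k i)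
  have h : ∀ i j, Filter.Tendsto (fun k => x k i j) Filter.atTop (nhds (⨆ k, x k i j)) :=
    fun i j => tendsto_atTop_ciSup (hmono i j) (hbdd i j)
  exact ⟨fun i j => ⨆ k, x k i j, tendsto_pi_nhds.2 fun i => tendsto_pi_nhds.2 (h i), h⟩

/-- The defect `X C X - X D - A X + B` of `X` in the Riccati equation. -/
def riccatiResidual {ι κ : Type*} [Fintype ι] [Fintype κ] (A : Matrix ι ι ℝ) (B : Matrix ι κ ℝ)
    (C : Matrix κ ι ℝ) (D : Matrix κ κ ℝ) (X : Matrix ι κ ℝ) : Matrix ι κ ℝ :=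
  X * C * X - X * D - A * X + B

theorem Filter.Tendsto.matrix_mul {p q r α : Type*} [Fintype q] {l : Filter α}
    {P : α → Matrix p q ℝ} {Q : α → Matrix q r ℝ} {P' : Matrix p q ℝ} {Q' : Matrix q r ℝ}
    (hP : Filter.Tendsto P l (nhds P')) (hQ : Filter.Tendsto Q l (nhds Q')) :
    Filter.Tendsto (fun k => P k * Q k) l (nhds (P' * Q')) := by
  have hc : Continuous fun z : Matrix p q ℝ × Matrix q r ℝ => z.1 * z.2 :=
    continuous_fst.matrix_mul continuous_snd
  exact Filter.Tendsto.comp (hc.tendsto (P', Q')) (hP.prodMk_nhds hQ)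

theorem tendsto_riccatiResidual {ι κ α : Type*} [Fintype ι] [Fintype κ] {l : Filter α}
    (B : Matrix ι κ ℝ) (C : Matrix κ ι ℝ) {a : α → Matrix ι ι ℝ} {d : α → Matrix κ κ ℝ}
    {x : α → Matrix ι κ ℝ} {A : Matrix ι ι ℝ} {D : Matrix κ κ ℝ} {X : Matrix ι κ ℝ}
    (ha : Filter.Tendsto a l (nhds A)) (hd : Filter.Tendsto d l (nhds D))
    (hx : Filter.Tendsto x l (nhds X)) :
    Filter.Tendsto (fun k => riccatiResidual (a k) B C (d k) (x k)) l
      (nhds (riccatiResidual A B C D X)) := by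
  have h1 := (hx.matrix_mul (tendsto_const_nhds (x := C))).matrix_mul hx
  have h2 := hx.matrix_mul hd
  have h3 := ha.matrix_mul hx
  unfold riccatiResidual
  exact ((h1.sub h2).sub h3).add (tendsto_const_nhds (x := B))

variable {ι κ : Type*} [Fintype ι] [Fintype κ] [DecidableEq ι] [DecidableEq κ]

/-- The negated off-diagonal part of a matrix. -/
def negOffDiag {ι : Type*} [DecidableEq ι] (M : Matrix ι ι ℝ) : Matrix ι ι ℝ :=
  diagonal M.diag - M

theorem IsZMatrix.negOffDiag_nonneg {ι : Type*} [DecidableEq ι] {M : Matrix ι ι ℝ} (hM : IsZMatrix M) (i j : ι) :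
    0 ≤ negOffDiag M i j := by
  by_cases h : i = j
  · subst h; simp [negOffDiag]
  · simpa [negOffDiag, h] using hM i j h

/-- One step of the Jacobi-type iteration: the diagonal parts of `A` and `D` stay on the left and are
inverted. When they are positive and `A`, `D` are `Z`-matrices with `C ≥ 0`, the step is entrywise
monotone on `X ≥ 0`. -/
noncomputable def riccatiStep (A : Matrix ι ι ℝ) (B : Matrix ι κ ℝ)
    (C : Matrix κ ι ℝ) (D : Matrix κ κ ℝ) (X : Matrix ι κ ℝ) : Matrix ι κ ℝ :=
  of fun i j => (X * C * X + X * negOffDiag D + negOffDiag A * X + B) i j / (A i i + D j j)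

variable {A : Matrix ι ι ℝ} {B : Matrix ι κ ℝ} {C : Matrix κ ι ℝ} {D : Matrix κ κ ℝ}

theorem riccatiStep_eq (hA : ∀ i, 0 < A i i) (hD : ∀ i, 0 < D i i) (X : Matrix ι κ ℝ) (i : ι)
    (j : κ) :
    riccatiStep A B C D X i j = X i j + riccatiResidual A B C D X i j / (A i i + D j j) := by
  have h : A i i + D j j ≠ 0 := (add_pos (hA i) (hD j)).ne'
  have hnum : (X * C * X + X * negOffDiag D + negOffDiag A * X + B) i j =
      X i j * (A i i + D j j) + riccatiResidual A B C D X i j := by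
    simp only [riccatiResidual, negOffDiag, Matrix.mul_sub, Matrix.sub_mul, Matrix.add_apply,
      Matrix.sub_apply, mul_diagonal, diagonal_mul, diag_apply]
    ring
  rw [riccatiStep, of_apply, hnum, add_div, mul_div_cancel_right₀ _ h]

theorem riccatiStep_mono (hA : ∀ i, 0 < A i i) (hD : ∀ i, 0 < D i i) (hAZ : IsZMatrix A)
    (hDZ : IsZMatrix D) (hC : ∀ i j, 0 ≤ C i j) {X Y : Matrix ι κ ℝ} (hX : ∀ i j, 0 ≤ X i j)
    (hXY : ∀ i j, X i j ≤ Y i j) (i : ι) (j : κ) :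
    riccatiStep A B C D X i j ≤ riccatiStep A B C D Y i j := by
  have hY : ∀ i j, 0 ≤ Y i j := fun i j => (hX i j).trans (hXY i j)
  simp only [riccatiStep, of_apply]
  refine div_le_div_of_nonneg_right ?_ (add_pos (hA i) (hD j)).le
  simp only [Matrix.add_apply]
  have h1 := mul_apply_le_mul_apply
    (mul_apply_le_mul_apply hXY (fun i j => le_refl (C i j)) hY hC) hXY (mul_apply_nonneg hY hC)
    hX i j
  have h2 := mul_apply_le_mul_apply hXY (fun i j => le_refl (negOffDiag D i j)) hY
    hDZ.negOffDiag_nonneg i j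
  have h3 := mul_apply_le_mul_apply (fun i j => le_refl (negOffDiag A i j)) hXY
    hAZ.negOffDiag_nonneg hX i j
  linarith

/-- The bound `X v₁ ≤ v₂` survives a step that increases `X`. -/
theorem riccatiStep_mulVec_le (hA : ∀ i, 0 < A i i) (hD : ∀ i, 0 < D i i) (hAZ : IsZMatrix A)
    {v₁ : κ → ℝ} {v₂ : ι → ℝ} (hv₁ : ∀ j, 0 < v₁ j)
    (h₁ : ∀ j, 0 ≤ (D *ᵥ v₁ - C *ᵥ v₂) j) (h₂ : ∀ i, 0 ≤ (A *ᵥ v₂ - B *ᵥ v₁) i)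
    (hC : ∀ i j, 0 ≤ C i j) {X : Matrix ι κ ℝ} (hX : ∀ i j, 0 ≤ X i j)
    (hXv : ∀ i, (X *ᵥ v₁) i ≤ v₂ i) (hstep : ∀ i j, X i j ≤ riccatiStep A B C D X i j) (i : ι) :
    (riccatiStep A B C D X *ᵥ v₁) i ≤ v₂ i := by
  set X' := riccatiStep A B C D X with hX'
  have key : diagonal A.diag * X' + X' * diagonal D.diag =
      X * C * X + X * negOffDiag D + negOffDiag A * X + B := by
    ext i j
    have h : A i i + D j j ≠ 0 := (add_pos (hA i) (hD j)).ne'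
    have hij : X' i j = (X * C * X + X * negOffDiag D + negOffDiag A * X + B) i j /
        (A i i + D j j) := rfl
    rw [Matrix.add_apply, diagonal_mul, mul_diagonal, diag_apply, diag_apply, hij]
    field_simp
  have key' := congrFun (congrArg (· *ᵥ v₁) key) i
  simp only [add_mulVec, ← mulVec_mulVec, Pi.add_apply] at key'
  rw [mulVec_diagonal, diag_apply] at key'
  -- `X C X v₁ ≤ X C v₂ ≤ X D v₁`
  have e1 : (X *ᵥ (C *ᵥ (X *ᵥ v₁))) i ≤ (X *ᵥ (D *ᵥ v₁)) i :=
    mulVec_apply_mono hX (fun j => (mulVec_apply_mono hC hXv j).trans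
      (by simpa using h₁ j)) i
  have e2 : (X *ᵥ (negOffDiag D *ᵥ v₁)) i =
      (X *ᵥ (diagonal D.diag *ᵥ v₁)) i - (X *ᵥ (D *ᵥ v₁)) i := by
    rw [negOffDiag, sub_mulVec, mulVec_sub, Pi.sub_apply]
  have e3 : (negOffDiag A *ᵥ (X *ᵥ v₁)) i ≤ A i i * v₂ i - (A *ᵥ v₂) i := by
    refine (mulVec_apply_mono hAZ.negOffDiag_nonneg hXv i).trans (le_of_eq ?_)
    rw [negOffDiag, sub_mulVec, Pi.sub_apply, mulVec_diagonal, diag_apply]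
  have e4 : (X *ᵥ (diagonal D.diag *ᵥ v₁)) i ≤ (X' *ᵥ (diagonal D.diag *ᵥ v₁)) i :=
    Finset.sum_le_sum fun j _ => mul_le_mul_of_nonneg_right (hstep i j) (by
      rw [mulVec_diagonal]; exact (mul_pos (hD j) (hv₁ j)).le)
  have e5 : (B *ᵥ v₁) i ≤ (A *ᵥ v₂) i := by simpa using h₂ i
  exact le_of_mul_le_mul_left (by linarith) (hA i)

/-- The iteration from `0` increases to a solution of the Riccati equation which lies below every
nonnegative supersolution. -/
theorem exists_minimal_solution_of_pos (hAZ : IsZMatrix A) (hDZ : IsZMatrix D)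
    (hB : ∀ i j, 0 ≤ B i j) (hC : ∀ i j, 0 ≤ C i j)
    {v₁ : κ → ℝ} {v₂ : ι → ℝ} (hv₁ : ∀ j, 0 < v₁ j) (hv₂ : ∀ i, 0 < v₂ i)
    (h₁ : ∀ j, 0 < (D *ᵥ v₁ - C *ᵥ v₂) j) (h₂ : ∀ i, 0 < (A *ᵥ v₂ - B *ᵥ v₁) i) :
    ∃ X : Matrix ι κ ℝ, (∀ i j, 0 ≤ X i j) ∧ riccatiResidual A B C D X = 0 ∧
      (∀ i, (X *ᵥ v₁) i ≤ v₂ i) ∧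
      ∀ Y : Matrix ι κ ℝ, (∀ i j, 0 ≤ Y i j) → (∀ i j, riccatiResidual A B C D Y i j ≤ 0) →
        ∀ i j, X i j ≤ Y i j := by
  have hD : ∀ j, 0 < D j j := fun j => (hDZ.pos_of_mulVec_pos (fun i => (hv₁ i).le) (i := j) (by
    have := h₁ j
    have := mulVec_apply_nonneg hC (fun i => (hv₂ i).le) j
    simp only [Pi.sub_apply] at *
    linarith)).1
  have hA : ∀ i, 0 < A i i := fun i => (hAZ.pos_of_mulVec_pos (fun i => (hv₂ i).le) (i := i) (by
    have := h₂ i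
    have := mulVec_apply_nonneg hB (fun i => (hv₁ i).le) i
    simp only [Pi.sub_apply] at *
    linarith)).1
  obtain ⟨x, hx0, hxs⟩ : ∃ x : ℕ → Matrix ι κ ℝ,
      x 0 = 0 ∧ ∀ k, x (k + 1) = riccatiStep A B C D (x k) :=
    ⟨fun k => (riccatiStep A B C D)^[k] 0, rfl, fun k => Function.iterate_succ_apply' _ k 0⟩
  have hinc : ∀ k, (∀ i j, 0 ≤ x k i j) ∧ ∀ i j, x k i j ≤ riccatiStep A B C D (x k) i j := by
    intro k
    induction k with
    | zero =>
      refine ⟨fun i j => le_of_eq (by simp [hx0]), fun i j => ?_⟩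
      simp only [hx0, riccatiStep, of_apply, Matrix.zero_apply, Matrix.zero_mul, Matrix.mul_zero,
        zero_add]
      exact div_nonneg (hB i j) (add_pos (hA i) (hD j)).le
    | succ k ih =>
      rw [hxs]
      exact ⟨fun i j => (ih.1 i j).trans (ih.2 i j),
        riccatiStep_mono hA hD hAZ hDZ hC ih.1 ih.2⟩
  have hbd : ∀ k i, (x k *ᵥ v₁) i ≤ v₂ i := by
    intro k
    induction k with
    | zero => intro i; simpa [hx0] using (hv₂ i).le
    | succ k ih =>
      rw [hxs]
      exact riccatiStep_mulVec_le hA hD hAZ hv₁ (fun j => (h₁ j).le) (fun i => (h₂ i).le) hC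
        (hinc k).1 ih (hinc k).2
  have hmono : ∀ i j, Monotone fun k => x k i j := fun i j =>
    monotone_nat_of_le_succ fun k => by simpa only [hxs] using (hinc k).2 i j
  obtain ⟨X, hlim, hlim'⟩ := exists_tendsto_of_monotone_of_mulVec_le hv₁ (fun k => (hinc k).1) hmono hbd
  refine ⟨X, fun i j => ge_of_tendsto' (hlim' i j) fun k => (hinc k).1 i j, ?_, fun i => ?_, ?_⟩
  · have hres : Filter.Tendsto (fun k => riccatiResidual A B C D (x k)) Filter.atTop
        (nhds (riccatiResidual A B C D X)) :=
      tendsto_riccatiResidual B C tendsto_const_nhds tendsto_const_nhds hlim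
    ext i j
    have hne := (add_pos (hA i) (hD j)).ne'
    have h1 : Filter.Tendsto (fun k => (x (k + 1) i j - x k i j) * (A i i + D j j)) Filter.atTop
        (nhds ((X i j - X i j) * (A i i + D j j))) :=
      (((Filter.tendsto_add_atTop_iff_nat 1).2 (hlim' i j)).sub (hlim' i j)).mul_const _
    have h2 : ∀ k, (x (k + 1) i j - x k i j) * (A i i + D j j) =
        riccatiResidual A B C D (x k) i j := fun k => by
      rw [hxs, riccatiStep_eq hA hD, add_sub_cancel_left, div_mul_cancel₀ _ hne]
    have h3 := tendsto_pi_nhds.1 (tendsto_pi_nhds.1 hres i) j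
    simpa using tendsto_nhds_unique h3 (h1.congr h2)
  · have h : Filter.Tendsto (fun k => ∑ j, x k i j * v₁ j) Filter.atTop
        (nhds (∑ j, X i j * v₁ j)) :=
      tendsto_finsetSum _ fun j _ => (hlim' i j).mul_const (v₁ j)
    exact le_of_tendsto' h fun k => hbd k i
  · intro Y hY hres i j
    have hTY : ∀ i j, riccatiStep A B C D Y i j ≤ Y i j := fun i j => by
      rw [riccatiStep_eq hA hD]
      have := div_nonpos_of_nonpos_of_nonneg (hres i j) (add_pos (hA i) (hD j)).le
      linarith
    have hle : ∀ k i j, x k i j ≤ Y i j := by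
      intro k
      induction k with
      | zero => intro i j; simpa [hx0] using hY i j
      | succ k ih =>
        intro i j
        rw [hxs]
        exact (riccatiStep_mono hA hD hAZ hDZ hC (hinc k).1 ih i j).trans (hTY i j)
    exact le_of_tendsto' (hlim' i j) fun k => hle k i j

end Riccati

/-! ### The spectra of the closed-loop matrices -/

section ClosedLoop

variable {ι κ : Type*} {A : Matrix ι ι ℝ} {B : Matrix ι κ ℝ} {C : Matrix κ ι ℝ} {D : Matrix κ κ ℝ}

theorem IsZMatrix.sub_of_nonneg {M P : Matrix ι ι ℝ} (hM : IsZMatrix M)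
    (hP : ∀ i j, 0 ≤ P i j) : IsZMatrix (M - P) := fun i j hij => by
  have := hM i j hij
  have := hP i j
  simp only [Matrix.sub_apply]
  linarith

theorem isZMatrix_fromBlocks (hAZ : IsZMatrix A) (hDZ : IsZMatrix D) (hB : ∀ i j, 0 ≤ B i j)
    (hC : ∀ i j, 0 ≤ C i j) : IsZMatrix (fromBlocks D (-C) (-B) A) := by
  rintro (i | i) (j | j) hij
  · exact hDZ i j fun h => hij (by rw [h])
  · simpa using hC i j
  · simpa using hB i j
  · exact hAZ i j fun h => hij (by rw [h])

theorem IsZMatrix.add_smul_one [DecidableEq ι] {M : Matrix ι ι ℝ} (hM : IsZMatrix M)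
    (a : ℝ) :
    IsZMatrix (M + a • 1) := fun i j hij => by simpa [hij] using hM i j hij

variable [Fintype ι] [Fintype κ]

theorem sub_mulVec_apply_le {v₁ : κ → ℝ} {v₂ : ι → ℝ} (hC : ∀ i j, 0 ≤ C i j) {X : Matrix ι κ ℝ}
    (hXv : ∀ i, (X *ᵥ v₁) i ≤ v₂ i) (j : κ) :
    (D *ᵥ v₁ - C *ᵥ v₂) j ≤ ((D - C * X) *ᵥ v₁) j := by
  have h := mulVec_apply_mono hC hXv j
  rw [sub_mulVec, ← mulVec_mulVec, Pi.sub_apply, Pi.sub_apply]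
  linarith

variable [DecidableEq ι] [DecidableEq κ]

/-- Let `u = (u₁, u₂)` be a nonnegative row vector with `u K = (p, q) > 0`. The Riccati equation
gives `(u₁ - u₂ X) (D - C X) = p + q X ≥ 0`, so `u₁ - u₂ X ≥ 0` by monotonicity of `D - C X`, and
then `u₂ (A - X C) = q + (u₁ - u₂ X) C > 0`. -/
theorem exists_pos_vecMul_sub_mul_pos (hAZ : IsZMatrix A) (hDZ : IsZMatrix D)
    (hB : ∀ i j, 0 ≤ B i j) (hC : ∀ i j, 0 ≤ C i j)
    {v₁ : κ → ℝ} {v₂ : ι → ℝ} (hv₁ : ∀ j, 0 < v₁ j) (hv₂ : ∀ i, 0 < v₂ i)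
    (h₁ : ∀ j, 0 < (D *ᵥ v₁ - C *ᵥ v₂) j) (h₂ : ∀ i, 0 < (A *ᵥ v₂ - B *ᵥ v₁) i)
    {X : Matrix ι κ ℝ} (hX : ∀ i j, 0 ≤ X i j) (hres : riccatiResidual A B C D X = 0)
    (hXv : ∀ i, (X *ᵥ v₁) i ≤ v₂ i) :
    ∃ w : ι → ℝ, (∀ i, 0 < w i) ∧ ∀ i, 0 < (w ᵥ* (A - X * C)) i := by
  obtain ⟨u, hu0, hu⟩ := (isZMatrix_fromBlocks hAZ hDZ hB hC).exists_vecMul_pos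
    (v := Sum.elim v₁ v₂) (by rintro (i | i); exacts [hv₁ i, hv₂ i]) (by
      rw [fromBlocks_mulVec]
      simp only [Sum.elim_comp_inl, Sum.elim_comp_inr, neg_mulVec]
      rintro (i | i)
      · simpa [sub_eq_add_neg] using h₁ i
      · simpa [sub_eq_add_neg, add_comm] using h₂ i)
  rw [vecMul_fromBlocks] at hu
  set u₁ : κ → ℝ := u ∘ Sum.inl
  set u₂ : ι → ℝ := u ∘ Sum.inr with hu₂
  have hp : ∀ j, 0 < (u₁ ᵥ* D - u₂ ᵥ* B) j := fun j => by
    simpa [vecMul_neg, sub_eq_add_neg] using hu (Sum.inl j)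
  have hq : ∀ i, 0 < (u₂ ᵥ* A - u₁ ᵥ* C) i := fun i => by
    simpa [vecMul_neg, sub_eq_add_neg, add_comm] using hu (Sum.inr i)
  have hRZ : IsZMatrix (D - C * X) := hDZ.sub_of_nonneg (mul_apply_nonneg hC hX)
  have hw₁ : ∀ j, 0 ≤ (u₁ - u₂ ᵥ* X) j := by
    refine hRZ.nonneg_of_vecMul_nonneg hv₁
      (fun j => (h₁ j).trans_le (sub_mulVec_apply_le hC hXv j)) fun j => ?_
    have e : (u₁ - u₂ ᵥ* X) ᵥ* (D - C * X) =
        (u₁ ᵥ* D - u₂ ᵥ* B) + (u₂ ᵥ* A - u₁ ᵥ* C) ᵥ* X := by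
      have h := congrArg (u₂ ᵥ* ·) hres
      simp only [riccatiResidual, vecMul_add, vecMul_sub, vecMul_zero] at h
      simp only [sub_vecMul, vecMul_sub, vecMul_vecMul]
      rw [← Matrix.mul_assoc, ← sub_eq_zero, ← h]
      abel
    rw [e, Pi.add_apply]
    exact add_nonneg (hp j).le (Finset.sum_nonneg fun i _ => mul_nonneg (hq i).le (hX i j))
  have hS : ∀ i, 0 < (u₂ ᵥ* (A - X * C)) i := fun i => by
    have e : u₂ ᵥ* (A - X * C) = (u₂ ᵥ* A - u₁ ᵥ* C) + (u₁ - u₂ ᵥ* X) ᵥ* C := by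
      simp only [sub_vecMul, vecMul_sub, vecMul_vecMul]
      abel
    rw [e, Pi.add_apply]
    exact add_pos_of_pos_of_nonneg (hq i)
      (Finset.sum_nonneg fun j _ => mul_nonneg (hw₁ j) (hC j i))
  have hSZ : IsZMatrix (A - X * C)ᵀ := fun i j hij =>
    hAZ.sub_of_nonneg (mul_apply_nonneg hX hC) j i hij.symm
  refine ⟨u₂, fun i => (hSZ.pos_of_mulVec_pos (fun j => hu0 (Sum.inr j)) ?_).2, hS⟩
  rw [mulVec_transpose]
  exact hS i

theorem riccatiResidual_add_smul_one (a : ℝ) (X : Matrix ι κ ℝ) :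
    riccatiResidual (A + a • 1) B C (D + a • 1) X = riccatiResidual A B C D X - (2 * a) • X := by
  simp only [riccatiResidual, Matrix.mul_add, Matrix.add_mul, Matrix.mul_smul, Matrix.smul_mul,
    Matrix.mul_one, Matrix.one_mul, two_mul, add_smul]
  abel

/-- The minimal solution is the increasing limit of those for `A + ε I`, `D + ε I`, where
`K + ε I` is nonsingular. This carries the location of the spectrum of `A - X C` to the limit. -/
theorem exists_minimal_solution (hAZ : IsZMatrix A) (hDZ : IsZMatrix D)
    (hB : ∀ i j, 0 ≤ B i j) (hC : ∀ i j, 0 ≤ C i j)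
    {v₁ : κ → ℝ} {v₂ : ι → ℝ} (hv₁ : ∀ j, 0 < v₁ j) (hv₂ : ∀ i, 0 < v₂ i)
    (h₁ : ∀ j, 0 ≤ (D *ᵥ v₁ - C *ᵥ v₂) j) (h₂ : ∀ i, 0 ≤ (A *ᵥ v₂ - B *ᵥ v₁) i) :
    ∃ X : Matrix ι κ ℝ, (∀ i j, 0 ≤ X i j) ∧ riccatiResidual A B C D X = 0 ∧
      (∀ Y : Matrix ι κ ℝ, (∀ i j, 0 ≤ Y i j) → riccatiResidual A B C D Y = 0 →
        ∀ i j, X i j ≤ Y i j) ∧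
      (∀ z ∈ complexEigenvalues (D - C * X), 0 < z.re ∨ z = 0) ∧
      ∀ z ∈ complexEigenvalues (A - X * C), 0 < z.re ∨ z = 0 := by
  obtain ⟨ε, hε0, hεanti, hεle, hεlim⟩ : ∃ ε : ℕ → ℝ, (∀ k, 0 < ε k) ∧ (∀ k, ε (k + 1) ≤ ε k) ∧
      (∀ k, ε k ≤ 1) ∧ Filter.Tendsto ε Filter.atTop (nhds 0) :=
    ⟨fun k => 1 / ((k : ℝ) + 1), fun k => Nat.one_div_pos_of_nat,
      fun k => Nat.one_div_le_one_div k.le_succ,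
      fun k => by simpa using Nat.one_div_le_one_div (α := ℝ) k.zero_le,
      tendsto_one_div_add_atTop_nhds_zero_nat⟩
  have hAε : ∀ k, IsZMatrix (A + ε k • 1) := fun k => hAZ.add_smul_one _
  have hDε : ∀ k, IsZMatrix (D + ε k • 1) := fun k => hDZ.add_smul_one _
  have h₁ε : ∀ k j, 0 < ((D + ε k • (1 : Matrix κ κ ℝ)) *ᵥ v₁ - C *ᵥ v₂) j :=
      fun k j => by
    have e1 := h₁ j
    have e2 := mul_pos (hε0 k) (hv₁ j)
    simp only [add_mulVec, smul_mulVec, one_mulVec, Pi.sub_apply, Pi.add_apply, Pi.smul_apply,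
      smul_eq_mul] at e1 ⊢
    linarith
  have h₂ε : ∀ k i, 0 < ((A + ε k • (1 : Matrix ι ι ℝ)) *ᵥ v₂ - B *ᵥ v₁) i :=
      fun k i => by
    have e1 := h₂ i
    have e2 := mul_pos (hε0 k) (hv₂ i)
    simp only [add_mulVec, smul_mulVec, one_mulVec, Pi.sub_apply, Pi.add_apply, Pi.smul_apply,
      smul_eq_mul] at e1 ⊢
    linarith
  choose x hx0 hxres hxv hxmin using fun k =>
    exists_minimal_solution_of_pos (hAε k) (hDε k) hB hC hv₁ hv₂ (h₁ε k) (h₂ε k)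
  have hmono : ∀ i j, Monotone fun k => x k i j := fun i j =>
    monotone_nat_of_le_succ fun k => hxmin k _ (hx0 (k + 1)) (fun i j => by
      have h := hxres (k + 1)
      rw [riccatiResidual_add_smul_one, sub_eq_zero] at h
      rw [riccatiResidual_add_smul_one, h, ← sub_smul, Matrix.smul_apply, smul_eq_mul]
      exact mul_nonpos_of_nonpos_of_nonneg (by linarith [hεanti k]) (hx0 _ i j)) i j
  obtain ⟨X, hlim, hlim'⟩ := exists_tendsto_of_monotone_of_mulVec_le hv₁ hx0 hmono hxv
  have hX0 : ∀ i j, 0 ≤ X i j := fun i j => ge_of_tendsto' (hlim' i j) fun k => hx0 k i j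
  have hAlim : Filter.Tendsto (fun k => A + ε k • (1 : Matrix ι ι ℝ)) Filter.atTop (nhds A) := by
    simpa using (tendsto_const_nhds (x := A)).add (hεlim.smul_const (1 : Matrix ι ι ℝ))
  have hDlim : Filter.Tendsto (fun k => D + ε k • (1 : Matrix κ κ ℝ)) Filter.atTop (nhds D) := by
    simpa using (tendsto_const_nhds (x := D)).add (hεlim.smul_const (1 : Matrix κ κ ℝ))
  have hXv : ∀ i, (X *ᵥ v₁) i ≤ v₂ i := fun i => by
    have h : Filter.Tendsto (fun k => ∑ j, x k i j * v₁ j) Filter.atTop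
        (nhds (∑ j, X i j * v₁ j)) :=
      tendsto_finsetSum _ fun j _ => (hlim' i j).mul_const (v₁ j)
    exact le_of_tendsto' h fun k => hxv k i
  refine ⟨X, hX0, ?_, fun Y hY hYres i j => ?_, fun z hz => ?_, fun z hz => ?_⟩
  · refine tendsto_nhds_unique (tendsto_riccatiResidual B C hAlim hDlim hlim) ?_
    simp only [hxres]
    exact tendsto_const_nhds
  · refine le_of_tendsto' (hlim' i j) fun k => hxmin k Y hY (fun i j => ?_) i j
    rw [riccatiResidual_add_smul_one, hYres, zero_sub, Matrix.neg_apply, Matrix.smul_apply,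
      smul_eq_mul, neg_nonpos]
    exact mul_nonneg (mul_nonneg zero_le_two (hε0 k).le) (hY i j)
  · have hR : IsZMatrix (D - C * X) := hDZ.sub_of_nonneg (mul_apply_nonneg hC hX0)
    exact re_pos_or_eq_zero_of_norm_sub_le (hR.norm_sub_le hv₁
      (fun j => (h₁ j).trans (sub_mulVec_apply_le hC hXv j))
      (s := ∑ j, |(D - C * X) j j|) (fun j => (le_abs_self _).trans
        (Finset.single_le_sum (f := fun j => |(D - C * X) j j|)
          (fun _ _ => abs_nonneg _) (Finset.mem_univ j))) hz)
  · -- One radius `s` serves all `k`, since `ε k ≤ 1` and `X C ≥ 0`.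
    set s : ℝ := ∑ i, |A i i| + 1 with hs
    refine re_pos_or_eq_zero_of_norm_sub_le (s := s) (norm_sub_le_of_tendsto
      (M := fun k => (A + ε k • 1) - x k * C) (hAlim.sub (hlim.matrix_mul tendsto_const_nhds))
      (fun k y hy => ?_) hz)
    obtain ⟨w, hw0, hw⟩ := exists_pos_vecMul_sub_mul_pos (hAε k) (hDε k) hB hC hv₁ hv₂ (h₁ε k)
      (h₂ε k) (hx0 k) (hxres k) (hxv k)
    have hSZ : IsZMatrix ((A + ε k • 1) - x k * C)ᵀ := fun i j hij =>
      (hAε k).sub_of_nonneg (mul_apply_nonneg (hx0 k) hC) j i hij.symm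
    refine hSZ.norm_sub_le hw0 (fun i => by rw [mulVec_transpose]; exact (hw i).le) (fun i => ?_)
      (by rwa [complexEigenvalues_transpose])
    have e1 := mul_apply_nonneg (hx0 k) hC i i
    have e2 := Finset.single_le_sum (f := fun j => |A j j|)
      (fun _ _ => abs_nonneg _) (Finset.mem_univ i)
    have e3 := le_abs_self (A i i)
    have e4 := hεle k
    simp only [transpose_apply, Matrix.sub_apply, Matrix.add_apply, Matrix.smul_apply, one_apply_eq,
      smul_eq_mul, mul_one]
    linarith

/-! ### Block triangularization of `H` -/

theorem complexEigenvalues_eq_map_charpoly_roots {ι : Type*} [Fintype ι] [DecidableEq ι]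
    (M : Matrix ι ι ℝ) :
    complexEigenvalues M = (M.charpoly.map Complex.ofRealHom).roots :=
  congrArg Polynomial.roots (charpoly_map M Complex.ofRealHom)

/-- The columns of `[I; X]` span an invariant subspace of `H`, so `H` is similar to
`[D - C X, -C; 0, -(A - X C)]`. -/
theorem complexEigenvalues_fromBlocks {X : Matrix ι κ ℝ} (hres : riccatiResidual A B C D X = 0) :
    complexEigenvalues (fromBlocks D (-C) B (-A)) =
      complexEigenvalues (D - C * X) + (complexEigenvalues (A - X * C)).map fun z => -z := by
  let L : (Matrix (κ ⊕ ι) (κ ⊕ ι) ℝ)ˣ :=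
    { val := fromBlocks 1 0 X 1
      inv := fromBlocks 1 0 (-X) 1
      val_inv := by simp [fromBlocks_multiply, fromBlocks_one]
      inv_val := by simp [fromBlocks_multiply, fromBlocks_one] }
  have h : fromBlocks D (-C) B (-A) =
      L.val * fromBlocks (D - C * X) (-C) 0 (-(A - X * C)) * L⁻¹.val := by
    have e : B = X * (D - C * X) + A * X := by
      rw [← sub_eq_zero, ← hres, riccatiResidual, Matrix.mul_sub, Matrix.mul_assoc]
      abel
    change _ = fromBlocks 1 0 X 1 * _ * fromBlocks 1 0 (-X) 1
    rw [fromBlocks_multiply, fromBlocks_multiply, fromBlocks_inj]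
    refine ⟨by simp, by simp, ?_, by simp [sub_eq_add_neg]⟩
    conv_lhs => rw [e]
    simp only [Matrix.one_mul, Matrix.mul_one, Matrix.mul_zero, add_zero, Matrix.mul_neg,
      Matrix.neg_mul, Matrix.add_mul, Matrix.sub_mul, neg_add, neg_neg, neg_sub]
    abel
  rw [h, ← complexEigenvalues_neg, complexEigenvalues_eq_map_charpoly_roots, coe_units_inv,
    charpoly_units_conj, charpoly_fromBlocks_zero₂₁, Polynomial.map_mul, Polynomial.roots_mul,
    ← complexEigenvalues_eq_map_charpoly_roots, ← complexEigenvalues_eq_map_charpoly_roots]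
  exact mul_ne_zero ((charpoly_monic _).map _).ne_zero ((charpoly_monic _).map _).ne_zero

/-- Exchanging the roles of the two equations replaces `H` by a permutation of `-H`. -/
theorem complexEigenvalues_fromBlocks_swap :
    complexEigenvalues (fromBlocks A (-B) C (-D)) =
      (complexEigenvalues (fromBlocks D (-C) B (-A))).map fun z => -z := by
  have h : fromBlocks A (-B) C (-D) =
      reindex (Equiv.sumComm κ ι) (Equiv.sumComm κ ι) (-fromBlocks D (-C) B (-A)) := by
    ext (i | i) (j | j) <;> simp
  rw [← complexEigenvalues_neg, h, complexEigenvalues_eq_map_charpoly_roots, charpoly_reindex,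
    ← complexEigenvalues_eq_map_charpoly_roots]

end ClosedLoop

theorem mainTheorem6 {n m : ℕ}
    (A : Matrix (Fin m) (Fin m) ℝ) (B : Matrix (Fin m) (Fin n) ℝ)
    (C : Matrix (Fin n) (Fin m) ℝ) (D : Matrix (Fin n) (Fin n) ℝ)
    (hK : IsRegularMMatrix (riccatiK A B C D)) :
    ∃ (Φ : Matrix (Fin m) (Fin n) ℝ) (Ψ : Matrix (Fin n) (Fin m) ℝ),
      IsMinimalNonnegSolution A B C D Φ ∧
      IsMinimalNonnegSolution D C B A Ψ ∧
      (∀ ev : Fin (n + m) → ℂ,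
        ListsEigenvalues (riccatiH A B C D) ev →
        (∀ i j, i ≤ j → (ev j).re ≤ (ev i).re) →
        ListsEigenvalues (A - Φ * C) (fun i : Fin m => -ev (Fin.natAdd n i)) ∧
        ListsEigenvalues (D - Ψ * B) (fun i : Fin n => ev (Fin.castAdd m i))) ∧
      (IsUnit (D - Ψ * B) ↔ IsUnit (D - C * Φ)) ∧
      (IsUnit (A - Φ * C) ↔ IsUnit (A - B * Ψ)) := by
  obtain ⟨⟨hZ, -⟩, v, hv, hKv⟩ := hK
  have hDZ : IsZMatrix D := fun i j hij => hZ (Sum.inl i) (Sum.inl j) (by simpa using hij)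
  have hAZ : IsZMatrix A := fun i j hij => hZ (Sum.inr i) (Sum.inr j) (by simpa using hij)
  have hC : ∀ i j, 0 ≤ C i j := fun i j => by
    simpa [riccatiK] using hZ (Sum.inl i) (Sum.inr j) (by simp)
  have hB : ∀ i j, 0 ≤ B i j := fun i j => by
    simpa [riccatiK] using hZ (Sum.inr i) (Sum.inl j) (by simp)
  have hv₁ : ∀ j, 0 < (v ∘ Sum.inl) j := fun j => hv (Sum.inl j)
  have hv₂ : ∀ i, 0 < (v ∘ Sum.inr) i := fun i => hv (Sum.inr i)
  rw [riccatiK, fromBlocks_mulVec] at hKv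
  have h₁ : ∀ j, 0 ≤ (D *ᵥ (v ∘ Sum.inl) - C *ᵥ (v ∘ Sum.inr)) j := fun j => by
    simpa [neg_mulVec, sub_eq_add_neg] using hKv (Sum.inl j)
  have h₂ : ∀ i, 0 ≤ (A *ᵥ (v ∘ Sum.inr) - B *ᵥ (v ∘ Sum.inl)) i := fun i => by
    simpa [neg_mulVec, sub_eq_add_neg, add_comm] using hKv (Sum.inr i)
  obtain ⟨Φ, hΦ0, hΦ, hΦmin, hΦR, hΦS⟩ :=
    exists_minimal_solution hAZ hDZ hB hC hv₁ hv₂ h₁ h₂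
  obtain ⟨Ψ, hΨ0, hΨ, hΨmin, hΨR, hΨS⟩ :=
    exists_minimal_solution hDZ hAZ hC hB hv₂ hv₁ h₂ h₁
  have hneg_re : ∀ {U : Multiset ℂ}, (∀ z ∈ U, 0 < z.re ∨ z = 0) →
      ∀ z ∈ U.map (fun z => -z), z.re < 0 ∨ z = 0 := by
    intro U hU z hz
    obtain ⟨y, hy, rfl⟩ := Multiset.mem_map.1 hz
    simpa using hU y hy
  have hneg_neg : ∀ U : Multiset ℂ, (U.map fun z => -z).map (fun z => -z) = U := fun U => by
    simp [Multiset.map_map]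
  have hH₁ := complexEigenvalues_fromBlocks hΦ
  have hH₂ : complexEigenvalues (fromBlocks D (-C) B (-A)) =
      complexEigenvalues (D - Ψ * B) + (complexEigenvalues (A - B * Ψ)).map fun z => -z := by
    rw [← hneg_neg (complexEigenvalues (fromBlocks D (-C) B (-A))),
      ← complexEigenvalues_fromBlocks_swap, complexEigenvalues_fromBlocks hΨ, Multiset.map_add,
      hneg_neg, add_comm]
  have hle : ∀ {U : Multiset ℂ}, (∀ z ∈ U, z.re < 0 ∨ z = 0) → ∀ z ∈ U, z.re ≤ 0 :=
    fun hU z hz => (hU z hz).elim le_of_lt fun h => by simp [h]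
  obtain ⟨hS, hT⟩ := eq_and_eq_of_add_eq_add (hH₁.symm.trans hH₂)
    (by rw [card_complexEigenvalues, card_complexEigenvalues]) hΦR (hle (hneg_re hΦS)) hΨS
    (hle (hneg_re hΨR))
  have hT' := congrArg (Multiset.map fun z : ℂ => -z) hT
  rw [hneg_neg, hneg_neg] at hT'
  refine ⟨Φ, Ψ, ⟨⟨hΦ0, hΦ⟩, fun Y hY => hΦmin Y hY.1 hY.2⟩,
    ⟨⟨hΨ0, hΨ⟩, fun Y hY => hΨmin Y hY.1 hY.2⟩, fun ev hev hsort => ?_, ?_, ?_⟩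
  · obtain ⟨hS', hT''⟩ := sorted_split (hH₁.symm.trans hev) hsort
      (by rw [card_complexEigenvalues, Fintype.card_fin])
      (by rw [Multiset.card_map, card_complexEigenvalues, Fintype.card_fin]) hΦR (hneg_re hΦS)
    refine ⟨?_, hS.symm.trans hS'⟩
    have h := congrArg (Multiset.map fun z : ℂ => -z) hT''
    rw [hneg_neg, Multiset.map_map] at h
    exact h
  · rw [isUnit_iff_zero_notMem_complexEigenvalues, isUnit_iff_zero_notMem_complexEigenvalues, hS]
  · rw [isUnit_iff_zero_notMem_complexEigenvalues, isUnit_iff_zero_notMem_complexEigenvalues, hT']
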